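/- Let $\mu$ be a Radon measure on $\mathbb{R}^n$ and let $\Lambda:\mathbb{R}^n\to GL(n,\mathbb{R})$ be an arbitrary map. For $a\in\mathbb{R}^n$ and $r>0$ put $T_{a,r}(y)=\frac{y-a}{r}$ and $T^{\Lambda}_{a,r}(y)=\Lambda(a)^{-1}\left(\frac{y-a}{r}\right)$, and write $T[\mu]$ for the image measure $T[\mu](E)=\mu(T^{-1}(E))$. For a Radon measure $\sigma$ on $\mathbb{R}^n$ let $\mathrm{Tan}(\sigma,a)$ be the set of all nonzero Radon measures $\nu$ on $\mathbb{R}^n$ for which there are $c_i>0$ and $r_i\downarrow 0$ such that $c_i\,T_{a,r_i}[\sigma]\to\nu$ in the weak-$*$ sense (that is, $\int f\,d(c_i T_{a,r_i}[\sigma])\to\int f\,d\nu$ for every $f\in C_c(\mathbb{R}^n)$), and let $\mathrm{Tan}_\Lambda(\mu,a)$ (the $\Lambda$-tangents of $\mu$ at $a$) be defined in the same way with $c_i\,T^{\Lambda}_{a,r_i}[\mu]$ in place of $c_i\,T_{a,r_i}[\sigma]$. Then for $\mu$-almost every $a\in\mathbb{R}^n$, every $\nu\in\mathrm{Tan}_\Lambda(\mu,a)$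 has the following two properties: 1. $T_{x,r}[\nu]\in\mathrm{Tan}_\Lambda(\mu,a)$ for all $x\in\operatorname{spt}\nu$ and all $r>0$; 2. $\mathrm{Tan}(\nu,x)\subset\mathrm{Tan}_\Lambda(\mu,a)$ for all $x\in\operatorname{spt}\nu$. -/

import Mathlib

open MeasureTheory Filter Topology
open scoped NNReal ENNReal CompactlySupported

noncomputable section

/-- Weak-* convergence of a sequence of measures: convergence of the integrals of every
continuous compactly supported real function. It is only used for Radon measures, for which
all these integrals are finite. -/
def WeakStarTendsto {X : Type*} [TopologicalSpace X] [MeasurableSpace X]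
    (μs : ℕ → Measure X) (ν : Measure X) : Prop :=
  ∀ f : C_c(X, ℝ), Tendsto (fun i => ∫ x, f x ∂(μs i)) atTop (𝓝 (∫ x, f x ∂ν))

/-- The translation and scaling map `T_{a,r}(y) = (y - a) / r` of `ℝⁿ`. -/
def transScale {n : ℕ} (a : EuclideanSpace ℝ (Fin n)) (r : ℝ) (y : EuclideanSpace ℝ (Fin n)) :
    EuclideanSpace ℝ (Fin n) :=
  r⁻¹ • (y - a)

/-- The rescaling `T^Λ_{a,r}(y) = Λ(a)⁻¹ ((y - a) / r)` of `ℝⁿ`. -/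
def transScaleLambda {n : ℕ} (Λ : EuclideanSpace ℝ (Fin n) → GL (Fin n) ℝ)
    (a : EuclideanSpace ℝ (Fin n)) (r : ℝ) (y : EuclideanSpace ℝ (Fin n)) :
    EuclideanSpace ℝ (Fin n) :=
  Matrix.toEuclideanCLM (𝕜 := ℝ) (((Λ a)⁻¹ : GL (Fin n) ℝ) : Matrix (Fin n) (Fin n) ℝ)
    (transScale a r y)

/-- `Tan(μ, a)`: the nonzero Radon measures `ν` that are weak-* limits of `c_i T_{a,r_i}[μ]`
with `c_i > 0`, `r_i > 0` and `r_i → 0`. (`Measure.Regular` is Mathlib's notion of a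
Radon measure.) -/
def Tan {n : ℕ} (μ : Measure (EuclideanSpace ℝ (Fin n))) (a : EuclideanSpace ℝ (Fin n)) :
    Set (Measure (EuclideanSpace ℝ (Fin n))) :=
  {ν | ν.Regular ∧ ν ≠ 0 ∧ ∃ (c : ℕ → ℝ≥0) (r : ℕ → ℝ),
    (∀ i, 0 < c i) ∧ (∀ i, 0 < r i) ∧ Tendsto r atTop (𝓝 0) ∧
    WeakStarTendsto (fun i => c i • μ.map (transScale a (r i))) ν}

/-- `Tan_Λ(μ, a)`, the `Λ`-tangents of `μ` at `a`: the nonzero Radon measures `ν` that are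
weak-* limits of `c_i T^Λ_{a,r_i}[μ]` with `c_i > 0`, `r_i > 0` and `r_i → 0`. -/
def LambdaTan {n : ℕ} (Λ : EuclideanSpace ℝ (Fin n) → GL (Fin n) ℝ)
    (μ : Measure (EuclideanSpace ℝ (Fin n))) (a : EuclideanSpace ℝ (Fin n)) :
    Set (Measure (EuclideanSpace ℝ (Fin n))) :=
  {ν | ν.Regular ∧ ν ≠ 0 ∧ ∃ (c : ℕ → ℝ≥0) (r : ℕ → ℝ),
    (∀ i, 0 < c i) ∧ (∀ i, 0 < r i) ∧ Tendsto r atTop (𝓝 0) ∧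
    WeakStarTendsto (fun i => c i • μ.map (transScaleLambda Λ a (r i))) ν}

end

/-!
Applying `L = Λ(a)⁻¹` carries the tangents of `μ` at `a` onto its `Λ`-tangents there, and
conjugating by `L` turns a blow-up at `x` into a blow-up at `L⁻¹ x`. This reduces the theorem to
`Λ = id`, with a null set that does not depend on `Λ`.

For `Λ = id` it suffices to translate `ν` by a point `x` of its support. Weak-* convergence is
tested by countably many functions, so if the translate is not a tangent at `a`, this is witnessed
by one of countably many sets: the set `B` of points `b` at which no multiple of a small-scale
blow-up of `μ` has its test integrals in a fixed basic open neighbourhood of those of the translate.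
If `a` is a density point of `B`, then, as `x` lies in the support of `ν`, there are `b ∈ B` with
`T_{a,r_i}(b)` close to `x`. The blow-up at `b` with scale `r_i` is the translate of the one at `a`
by `T_{a,r_i}(b)`, hence is close to the translate of `ν`, a contradiction. No measurability of `B`
is needed: Besicovitch's density theorem holds for outer measures of arbitrary sets.
-/

section WeightedApproximation

variable {X : Type*} [TopologicalSpace X]

theorem exists_compactlySupported_eq_one_on [RegularSpace X] [LocallyCompactSpace X] {K U : Set X}
    (hK : IsCompact K) (hU : IsOpen U) (hKU : K ⊆ U) :
    ∃ ψ : C_c(X, ℝ), (∀ x ∈ K, ψ x = 1) ∧ (∀ x ∉ U, ψ x = 0) ∧ ∀ x, ψ x ∈ Set.Icc 0 1 := by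
  obtain ⟨ψ, hψK, hψU, hψc, hψ⟩ := exists_continuous_one_zero_of_isCompact hK hU.isClosed_compl
    (Set.disjoint_compl_right_iff_subset.2 hKU)
  exact ⟨⟨ψ, hψc⟩, hψK, hψU, hψ⟩

theorem exists_countable_forall_weighted_approx (X : Type*) [TopologicalSpace X] [T2Space X]
    [LocallyCompactSpace X] [SecondCountableTopology X] :
    ∃ D : Set C_c(X, ℝ), D.Countable ∧
      ∀ f : C_c(X, ℝ), ∃ ψ ∈ D, ∀ ε > 0, ∃ g ∈ D, ∀ x, |f x - g x| ≤ ε * ψ x := by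
  let K : CompactExhaustion X := default
  choose ψ hψK _ hψ using fun n =>
    exists_compactlySupported_eq_one_on (K.isCompact n) isOpen_univ (Set.subset_univ _)
  let S (n : ℕ) : Set C(X, ℝ) := {h | ∀ x ∉ K n, h x = 0}
  let toCc (n : ℕ) (h : S n) : C_c(X, ℝ) := ⟨h.1, .intro (K.isCompact n) fun x hx => h.2 x hx⟩
  choose E hEc hEd using fun n => TopologicalSpace.exists_countable_dense (S n)
  refine ⟨Set.range ψ ∪ ⋃ n, toCc n '' E n, (Set.countable_range ψ).union
    (Set.countable_iUnion fun n => (hEc n).image _), fun f => ?_⟩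
  obtain ⟨n, hn⟩ := K.exists_superset_of_isCompact f.hasCompactSupport.isCompact
  have hf : ∀ x ∉ K n, f x = 0 := fun x hx => image_eq_zero_of_notMem_tsupport fun h => hx (hn h)
  refine ⟨ψ n, .inl ⟨n, rfl⟩, fun ε hε => ?_⟩
  have hnear : ∀ᶠ h : S n in 𝓝 ⟨f.toContinuousMap, hf⟩, ∀ x ∈ K n, dist (f x) (h.1 x) < ε :=
    Metric.tendstoUniformlyOn_iff.1
      (ContinuousMap.tendsto_iff_forall_isCompact_tendstoUniformlyOn.1
        (continuous_subtype_val.tendsto _) _ (K.isCompact n)) ε hε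
  obtain ⟨h, hhE, hh⟩ := (hEd n).inter_nhds_nonempty hnear
  refine ⟨toCc n h, .inr (Set.mem_iUnion.2 ⟨n, h, hhE, rfl⟩), fun x => ?_⟩
  change |f x - h.1 x| ≤ ε * ψ n x
  by_cases hx : x ∈ K n
  · rw [hψK n x hx, mul_one]
    exact (hh x hx).le
  · rw [hf x hx, h.2 x hx, sub_zero, abs_zero]
    exact mul_nonneg hε.le (hψ n x).1

theorem abs_integral_sub_integral_le_of_abs_sub_le {α : Type*} [MeasurableSpace α] {σ : Measure α}
    {h g ψ : α → ℝ} (hh : AEStronglyMeasurable h σ) (hg : Integrable g σ) (hψ : Integrable ψ σ)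
    {ε : ℝ} (hε : ∀ x, |h x - g x| ≤ ε * ψ x) :
    |∫ x, h x ∂σ - ∫ x, g x ∂σ| ≤ ε * ∫ x, ψ x ∂σ := by
  have hhg : Integrable (fun x => h x - g x) σ :=
    (hψ.const_mul ε).mono' (hh.sub hg.1) (.of_forall hε)
  have hh' : Integrable h σ := (hhg.add hg).congr (.of_forall fun x => sub_add_cancel (h x) (g x))
  rw [← integral_sub hh' hg, ← integral_const_mul]
  exact abs_integral_le_integral_abs.trans (integral_mono hhg.abs (hψ.const_mul ε) hε)

variable [MeasurableSpace X] [OpensMeasurableSpace X]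

theorem tendsto_integral_of_weighted_approx {ι : Type*} {l : Filter ι} {σ : ι → Measure X}
    {ν : Measure X} [∀ i, IsFiniteMeasureOnCompacts (σ i)] [IsFiniteMeasureOnCompacts ν]
    {h : ι → X → ℝ} {k : X → ℝ} (hh : ∀ i, AEStronglyMeasurable (h i) (σ i))
    (hk : AEStronglyMeasurable k ν) (ψ : C_c(X, ℝ))
    (hψ : Tendsto (fun i => ∫ x, ψ x ∂σ i) l (𝓝 (∫ x, ψ x ∂ν)))
    (happrox : ∀ ε > 0, ∃ g : C_c(X, ℝ),
      Tendsto (fun i => ∫ x, g x ∂σ i) l (𝓝 (∫ x, g x ∂ν)) ∧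
      (∀ x, |k x - g x| ≤ ε * ψ x) ∧ ∀ᶠ i in l, ∀ x, |h i x - g x| ≤ ε * ψ x) :
    Tendsto (fun i => ∫ x, h i x ∂σ i) l (𝓝 (∫ x, k x ∂ν)) := by
  rw [Metric.tendsto_nhds]
  intro ε hε
  set p := |∫ x, ψ x ∂ν|
  have hp : ∫ x, ψ x ∂ν ≤ p := le_abs_self _
  obtain ⟨δ, hδ, hδε⟩ : ∃ δ > 0, δ * (2 * p + 2) < ε := by
    refine ⟨ε / (2 * p + 3), by positivity, ?_⟩
    rw [div_mul_eq_mul_div, div_lt_iff₀ (by positivity)]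
    gcongr
    norm_num
  obtain ⟨g, hg, hkg, hhg⟩ := happrox δ hδ
  filter_upwards [hhg, Metric.tendsto_nhds.1 hg δ hδ,
    hψ.eventually_lt_const (hp.trans_lt (lt_add_one p))] with i hhgi hgi hψi
  have hhi := abs_integral_sub_integral_le_of_abs_sub_le (hh i) g.integrable ψ.integrable hhgi
  have hki := abs_integral_sub_integral_le_of_abs_sub_le hk g.integrable ψ.integrable hkg
  rw [abs_sub_comm] at hki
  rw [Real.dist_eq] at hgi ⊢
  calc |∫ x, h i x ∂σ i - ∫ x, k x ∂ν|
      ≤ |∫ x, h i x ∂σ i - ∫ x, g x ∂σ i| + |∫ x, g x ∂σ i - ∫ x, g x ∂ν|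
        + |∫ x, g x ∂ν - ∫ x, k x ∂ν| :=
        (abs_sub_le _ (∫ x, g x ∂ν) _).trans (by gcongr; exact abs_sub_le _ _ _)
    _ ≤ δ * (p + 1) + δ + δ * p := by
        gcongr
        · exact hhi.trans (by gcongr)
        · exact hki.trans (by gcongr)
    _ = δ * (2 * p + 2) := by ring
    _ < ε := hδε

end WeightedApproximation

section WeakStarConvergence

variable {X Y : Type*} [TopologicalSpace X] [MeasurableSpace X] [TopologicalSpace Y]
  [MeasurableSpace Y]

/-- The integrals of a measure against a family `D` of test functions, as a point of the product
space `D → ℝ`; for countable `D` this space is second countable. -/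
noncomputable def testVector (D : Set C_c(X, ℝ)) (σ : Measure X) : D → ℝ :=
  fun g => ∫ x, g.1 x ∂σ

/-- A family of test functions is convergence determining if weak-* convergence of measures that
are finite on compact sets can be checked on its elements. -/
def IsConvergenceDetermining (D : Set C_c(X, ℝ)) : Prop :=
  ∀ ⦃σ : ℕ → Measure X⦄ ⦃ν : Measure X⦄ [∀ i, IsFiniteMeasureOnCompacts (σ i)]
    [IsFiniteMeasureOnCompacts ν],
    Tendsto (fun i => testVector D (σ i)) atTop (𝓝 (testVector D ν)) → WeakStarTendsto σ ν

theorem exists_countable_isConvergenceDetermining (X : Type*) [TopologicalSpace X] [T2Space X]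
    [LocallyCompactSpace X] [SecondCountableTopology X] [MeasurableSpace X]
    [OpensMeasurableSpace X] :
    ∃ D : Set C_c(X, ℝ), D.Countable ∧ IsConvergenceDetermining D := by
  obtain ⟨D, hDc, hD⟩ := exists_countable_forall_weighted_approx X
  refine ⟨D, hDc, fun σ ν _ _ h f => ?_⟩
  have hlim (g) (hg : g ∈ D) : Tendsto (fun i => ∫ x, g x ∂σ i) atTop (𝓝 (∫ x, g x ∂ν)) :=
    tendsto_pi_nhds.1 h ⟨g, hg⟩
  obtain ⟨ψ, hψD, hψ⟩ := hD f
  refine tendsto_integral_of_weighted_approx (fun i => f.integrable.1) f.integrable.1 ψ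
    (hlim ψ hψD) fun ε hε => ?_
  obtain ⟨g, hgD, hg⟩ := hψ ε hε
  exact ⟨g, hlim g hgD, hg, .of_forall fun _ => hg⟩

namespace WeakStarTendsto

variable {σ : ℕ → Measure X} {ν : Measure X}

theorem tendsto_testVector (h : WeakStarTendsto σ ν) (D : Set C_c(X, ℝ)) :
    Tendsto (fun i => testVector D (σ i)) atTop (𝓝 (testVector D ν)) :=
  tendsto_pi_nhds.2 fun g => h g.1

theorem const_smul (h : WeakStarTendsto σ ν) (t : ℝ≥0) :
    WeakStarTendsto (fun i => t • σ i) (t • ν) := fun f => by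
  simp only [integral_smul_nnreal_measure]
  exact (h f).const_smul t

theorem map_homeomorph [BorelSpace X] [BorelSpace Y] (h : WeakStarTendsto σ ν) (e : X ≃ₜ Y) :
    WeakStarTendsto (fun i => (σ i).map e) (ν.map e) := fun f => by
  simp only [e.measurableEmbedding.integral_map]
  exact h ⟨f.toContinuousMap.comp e, f.hasCompactSupport.comp_homeomorph e⟩

theorem exists_eventually_lt_measure [RegularSpace X] [LocallyCompactSpace X]
    [OpensMeasurableSpace X] [IsFiniteMeasureOnCompacts ν] (h : WeakStarTendsto σ ν) {x : X}
    (hx : x ∈ ν.support) {U : Set X} (hU : IsOpen U) (hxU : x ∈ U) :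
    ∃ m : ℝ≥0∞, 0 < m ∧ ∀ᶠ i in atTop, m < σ i U := by
  obtain ⟨φ, hφx, hφU, hφ⟩ := exists_compactlySupported_eq_one_on (isCompact_singleton (x := x))
    hU (Set.singleton_subset_iff.2 hxU)
  have hpos : 0 < ∫ y, φ y ∂ν := by
    rw [integral_pos_iff_support_of_nonneg (fun y => (hφ y).1) φ.integrable]
    exact (Measure.mem_support_iff_forall x).1 hx _ (φ.continuous.isOpen_support.mem_nhds
      ((hφx x rfl).trans_ne one_ne_zero))
  obtain ⟨m, hm, hmφ⟩ := exists_between hpos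
  refine ⟨ENNReal.ofReal m, ENNReal.ofReal_pos.2 hm, ?_⟩
  filter_upwards [(h φ).eventually_const_lt hmφ] with i hi
  exact (ENNReal.ofReal_lt_ofReal_iff_of_nonneg hm.le |>.2 hi).trans_le
    (integral_le_measure (fun y _ => (hφ y).2) fun y hy => (hφU y hy).le)

theorem exists_eventually_measure_le [RegularSpace X] [LocallyCompactSpace X]
    [OpensMeasurableSpace X] [∀ i, IsFiniteMeasureOnCompacts (σ i)] (h : WeakStarTendsto σ ν)
    {K : Set X} (hK : IsCompact K) :
    ∃ M : ℝ≥0∞, M ≠ ∞ ∧ ∀ᶠ i in atTop, σ i K ≤ M := by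
  obtain ⟨ψ, hψK, -, hψ⟩ := exists_compactlySupported_eq_one_on hK isOpen_univ (Set.subset_univ K)
  refine ⟨ENNReal.ofReal (∫ y, ψ y ∂ν + 1), ENNReal.ofReal_ne_top, ?_⟩
  filter_upwards [(h ψ).eventually_lt_const (lt_add_one _)] with i hi
  exact (ψ.integrable.measure_le_integral (.of_forall fun y => (hψ y).1)
    fun y hy => (hψK y hy).ge).trans (ENNReal.ofReal_le_ofReal hi.le)

open scoped Pointwise in
theorem tendsto_integral_comp_sub {G : Type*} [NormedAddCommGroup G] [LocallyCompactSpace G]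
    [MeasurableSpace G] [BorelSpace G] {σ : ℕ → Measure G} {ν : Measure G}
    [∀ i, IsFiniteMeasureOnCompacts (σ i)] [IsFiniteMeasureOnCompacts ν]
    (h : WeakStarTendsto σ ν) (f : C_c(G, ℝ)) (x : G) :
    Tendsto (fun p : ℕ × G => ∫ z, f (z - p.2) ∂σ p.1) (atTop ×ˢ 𝓝 x)
      (𝓝 (∫ z, f (z - x) ∂ν)) := by
  obtain ⟨N, hN, hNx⟩ := exists_compact_mem_nhds x
  have hK : IsCompact (tsupport f + N) := f.hasCompactSupport.isCompact.add hN
  have hsupp : ∀ y ∈ N, ∀ z ∉ tsupport f + N, f (z - y) = 0 := fun y hy z hz =>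
    image_eq_zero_of_notMem_tsupport fun hzy => hz ⟨z - y, hzy, y, hy, sub_add_cancel z y⟩
  obtain ⟨ψ, hψK, -, hψ⟩ := exists_compactlySupported_eq_one_on hK isOpen_univ (Set.subset_univ _)
  let g : C_c(G, ℝ) := ⟨f.toContinuousMap.comp (Homeomorph.subRight x),
    f.hasCompactSupport.comp_homeomorph (Homeomorph.subRight x)⟩
  have hmeas (y : G) (τ : Measure G) : AEStronglyMeasurable (fun z => f (z - y)) τ :=
    (f.continuous.comp (continuous_sub_right y)).aestronglyMeasurable
  refine tendsto_integral_of_weighted_approx (σ := fun p : ℕ × G => σ p.1)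
    (fun p => hmeas p.2 _) (hmeas x ν) ψ ((h ψ).comp tendsto_fst) fun ε hε =>
      ⟨g, (h g).comp tendsto_fst, fun z => ?_, ?_⟩
  · change |f (z - x) - f (z - x)| ≤ ε * ψ z
    rw [sub_self, abs_zero]
    exact mul_nonneg hε.le (hψ z).1
  obtain ⟨δ, hδ, hfδ⟩ := Metric.uniformContinuous_iff.1
    (f.hasCompactSupport.uniformContinuous_of_continuous f.continuous) ε hε
  filter_upwards [tendsto_snd.eventually (Metric.ball_mem_nhds x hδ), tendsto_snd.eventually hNx]
    with ⟨i, y⟩ hyδ hyN z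
  change |f (z - y) - f (z - x)| ≤ ε * ψ z
  by_cases hz : z ∈ tsupport f + N
  · rw [hψK z hz, mul_one]
    exact (hfδ (by rwa [dist_sub_left])).le
  · rw [hsupp y hyN z hz, hsupp x (mem_of_mem_nhds hNx) z hz, sub_zero, abs_zero]
    exact mul_nonneg hε.le (hψ z).1

theorem tendsto_testVector_map_sub {G : Type*} [NormedAddCommGroup G] [LocallyCompactSpace G]
    [MeasurableSpace G] [BorelSpace G] {σ : ℕ → Measure G} {ν : Measure G}
    [∀ i, IsFiniteMeasureOnCompacts (σ i)] [IsFiniteMeasureOnCompacts ν]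
    (h : WeakStarTendsto σ ν) (D : Set C_c(G, ℝ)) (x : G) :
    Tendsto (fun p : ℕ × G => testVector D ((σ p.1).map (· - p.2))) (atTop ×ˢ 𝓝 x)
      (𝓝 (testVector D (ν.map (· - x)))) := by
  have htrans (τ : Measure G) (y : G) (g : D) :
      testVector D (τ.map (· - y)) g = ∫ z, g.1 (z - y) ∂τ :=
    (Homeomorph.subRight y).measurableEmbedding.integral_map _
  refine tendsto_pi_nhds.2 fun g => ?_
  simp only [htrans]
  exact h.tendsto_integral_comp_sub g.1 x

end WeakStarTendsto

theorem mem_support_map {μ : Measure X} {f : X → Y} {x : X} (hf : AEMeasurable f μ)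
    (hfx : ContinuousAt f x) (hx : x ∈ μ.support) : f x ∈ (μ.map f).support :=
  (Measure.mem_support_iff_forall _).2 fun _ hU =>
    ((Measure.mem_support_iff_forall x).1 hx _ (hfx hU)).trans_le (Measure.le_map_apply hf _)

end WeakStarConvergence

section Density

/-- `a` is a `μ`-density point of `B`, with respect to closed balls centred at `a`. The set `B` need
not be measurable, and then `μ` stands for the outer measure. -/
def IsDensityPoint {X : Type*} [PseudoMetricSpace X] [MeasurableSpace X] (μ : Measure X)
    (B : Set X) (a : X) : Prop :=
  Tendsto (fun r => μ (B ∩ Metric.closedBall a r) / μ (Metric.closedBall a r)) (𝓝[>] 0) (𝓝 1)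

theorem eventually_nonempty_inter_of_tendsto_measure_div {α ι : Type*} [MeasurableSpace α]
    {μ : Measure α} {l : Filter ι} {B : Set α} {K G : ι → Set α} {c : ι → ℝ≥0∞} {m M : ℝ≥0∞}
    (hB : Tendsto (fun i => μ (B ∩ K i) / μ (K i)) l (𝓝 1)) (hG : ∀ i, MeasurableSet (G i))
    (hGK : ∀ i, G i ⊆ K i) (hK : ∀ i, μ (K i) ≠ ∞) (hm : 0 < m) (hM : M ≠ ∞)
    (hmG : ∀ᶠ i in l, m < c i * μ (G i)) (hKM : ∀ᶠ i in l, c i * μ (K i) ≤ M) :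
    ∀ᶠ i in l, (B ∩ G i).Nonempty := by
  have hsmall : ∀ᶠ i in l, (1 - μ (B ∩ K i) / μ (K i)) * M < m := by
    have hlim := ENNReal.Tendsto.mul_const (ENNReal.Tendsto.sub tendsto_const_nhds hB
      (.inl ENNReal.one_ne_top)) (.inr hM)
    rw [tsub_self, zero_mul] at hlim
    exact hlim.eventually_lt_const hm
  filter_upwards [hsmall, hmG, hKM] with i hi hGi hKi
  have hK0 : μ (K i) ≠ 0 := fun h0 => by
    simp [measure_mono_null (hGK i) h0] at hGi
  have hBK : c i * μ (B ∩ K i) ≠ ∞ :=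
    ne_top_of_le_ne_top hM (hKi.trans' (by gcongr; exact Set.inter_subset_right))
  have hlt : c i * μ (K i) < c i * μ (B ∩ K i) + c i * μ (G i) := by
    set q := μ (B ∩ K i) / μ (K i)
    calc c i * μ (K i) ≤ (q + (1 - q)) * (c i * μ (K i)) := le_mul_of_one_le_left' le_add_tsub
      _ = c i * (q * μ (K i)) + (1 - q) * (c i * μ (K i)) := by ring
      _ ≤ c i * μ (B ∩ K i) + (1 - q) * M := by
        rw [ENNReal.div_mul_cancel hK0 (hK i)]
        gcongr
      _ < c i * μ (B ∩ K i) + c i * μ (G i) := ENNReal.add_lt_add_left hBK (hi.trans hGi)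
  exact (nonempty_inter_of_measure_lt_add (c i • μ) (hG i) Set.inter_subset_right (hGK i) hlt).mono
    fun y hy => ⟨hy.1.1, hy.2⟩

end Density

section Tangents

variable {E : Type*} [NormedAddCommGroup E] [NormedSpace ℝ E]

/-- Blow-up at `a` with scale `r`, followed by the linear automorphism `L`. With `L` the identity
this is `T_{a,r}`, with `L = Λ(a)⁻¹` it is `T^Λ_{a,r}`. At `r = 0` it is the constant map `0`. -/
noncomputable def rescale (L : E ≃L[ℝ] E) (a : E) (r : ℝ) (y : E) : E :=
  L (r⁻¹ • (y - a))

/-- `rescale L a r` as a homeomorphism. -/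
noncomputable def rescaleHomeomorph (L : E ≃L[ℝ] E) (a : E) {r : ℝ} (hr : r ≠ 0) : E ≃ₜ E :=
  (Homeomorph.subRight a).trans
    ((Homeomorph.smulOfNeZero r⁻¹ (inv_ne_zero hr)).trans L.toHomeomorph)

theorem coe_rescaleHomeomorph (L : E ≃L[ℝ] E) (a : E) {r : ℝ} (hr : r ≠ 0) :
    ⇑(rescaleHomeomorph L a hr) = rescale L a r :=
  rfl

theorem continuous_rescale (L : E ≃L[ℝ] E) (a : E) (r : ℝ) : Continuous (rescale L a r) :=
  L.continuous.comp ((continuous_sub_right a).const_smul r⁻¹)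

theorem rescale_sub_rescale (L : E ≃L[ℝ] E) (a b : E) (r : ℝ) (y : E) :
    rescale L a r y - rescale L a r b = rescale L b r y := by
  simp only [rescale, ← map_sub, ← smul_sub, sub_sub_sub_cancel_right]

theorem rescale_zero_rescale (L M : E ≃L[ℝ] E) (a : E) (r t : ℝ) (y : E) :
    rescale M 0 t (rescale L a r y) = rescale (L.trans M) a (r * t) y := by
  simp only [rescale, sub_zero, mul_inv_rev, mul_smul, map_smul, ContinuousLinearEquiv.trans_apply]

theorem rescale_refl_preimage_closedBall (a : E) {r : ℝ} (hr : 0 < r) (ρ : ℝ) :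
    rescale (.refl ℝ E) a r ⁻¹' Metric.closedBall 0 ρ = Metric.closedBall a (r * ρ) := by
  ext y
  rw [Set.mem_preimage, rescale, ContinuousLinearEquiv.refl_apply, mem_closedBall_zero_iff,
    mem_closedBall_iff_norm, norm_smul, norm_inv, Real.norm_of_nonneg hr.le, inv_mul_le_iff₀ hr]

variable [MeasurableSpace E]

/-- The tangent measures of `μ` at `a`, seen through the linear automorphism `L`: nonzero Radon
limits of `c_i • μ.map (rescale L a r_i)`. This is `Tan(μ, a)` for `L` the identity, and
`Tan_Λ(μ, a)` for `L = Λ(a)⁻¹`. -/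
def tangentMeasures (L : E ≃L[ℝ] E) (μ : Measure E) (a : E) : Set (Measure E) :=
  {ν | ν.Regular ∧ ν ≠ 0 ∧ ∃ (c : ℕ → ℝ≥0) (r : ℕ → ℝ),
    (∀ i, 0 < c i) ∧ (∀ i, 0 < r i) ∧ Tendsto r atTop (𝓝 0) ∧
    WeakStarTendsto (fun i => c i • μ.map (rescale L a (r i))) ν}

theorem smul_mem_tangentMeasures {L : E ≃L[ℝ] E} {μ ν : Measure E} {a : E}
    (hν : ν ∈ tangentMeasures L μ a) {t : ℝ≥0} (ht : 0 < t) : t • ν ∈ tangentMeasures L μ a := by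
  obtain ⟨_, hν0, c, r, hc, hr, hr0, hlim⟩ := hν
  refine ⟨inferInstance, smul_ne_zero ht.ne' hν0, fun i => t * c i, r, fun i => mul_pos ht (hc i),
    hr, hr0, ?_⟩
  simpa only [mul_smul] using hlim.const_smul t

variable [BorelSpace E]

theorem map_rescale_map_sub (μ : Measure E) (L : E ≃L[ℝ] E) (a b : E) (r : ℝ) :
    (μ.map (rescale L a r)).map (· - rescale L a r b) = μ.map (rescale L b r) := by
  rw [Measure.map_map (continuous_sub_right _).measurable (continuous_rescale L a r).measurable]
  exact congrArg μ.map (funext (rescale_sub_rescale L a b r))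

theorem map_rescale_map_rescale_zero (μ : Measure E) (L M : E ≃L[ℝ] E) (a : E) (r t : ℝ) :
    (μ.map (rescale L a r)).map (rescale M 0 t) = μ.map (rescale (L.trans M) a (r * t)) := by
  rw [Measure.map_map (continuous_rescale M 0 t).measurable (continuous_rescale L a r).measurable]
  exact congrArg μ.map (funext (rescale_zero_rescale L M a r t))

theorem regular_map_rescale (μ : Measure E) [μ.Regular] (L : E ≃L[ℝ] E) (a : E) {r : ℝ}
    (hr : r ≠ 0) : (μ.map (rescale L a r)).Regular :=
  Measure.Regular.map (rescaleHomeomorph L a hr)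

theorem map_rescale_zero_mem_tangentMeasures {L : E ≃L[ℝ] E} {μ ν : Measure E} {a : E}
    (hν : ν ∈ tangentMeasures L μ a) (M : E ≃L[ℝ] E) {t : ℝ} (ht : 0 < t) :
    ν.map (rescale M 0 t) ∈ tangentMeasures (L.trans M) μ a := by
  obtain ⟨_, hν0, c, r, hc, hr, hr0, hlim⟩ := hν
  refine ⟨regular_map_rescale ν M 0 ht.ne',
    (Measure.map_ne_zero_iff (continuous_rescale M 0 t).aemeasurable).2 hν0, c, fun i => r i * t,
    hc, fun i => mul_pos (hr i) ht, by simpa only [zero_mul] using hr0.mul_const t, ?_⟩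
  simpa only [coe_rescaleHomeomorph, Measure.map_smul, map_rescale_map_rescale_zero] using
    hlim.map_homeomorph (rescaleHomeomorph M 0 ht.ne')

theorem map_rescale_mem_tangentMeasures_of_map_sub_mem {μ : Measure E} {a : E}
    (h : ∀ ν ∈ tangentMeasures (.refl ℝ E) μ a, ∀ x ∈ ν.support,
      ν.map (· - x) ∈ tangentMeasures (.refl ℝ E) μ a)
    {L : E ≃L[ℝ] E} {ν : Measure E} (hν : ν ∈ tangentMeasures L μ a) {x : E}
    (hx : x ∈ ν.support) {r : ℝ} (hr : 0 < r) :
    ν.map (rescale (.refl ℝ E) x r) ∈ tangentMeasures L μ a := by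
  let T := rescale L.symm 0 1
  have hT : Continuous T := continuous_rescale L.symm 0 1
  have hνT : ν.map T ∈ tangentMeasures (.refl ℝ E) μ a := by
    simpa only [ContinuousLinearEquiv.self_trans_symm] using
      map_rescale_zero_mem_tangentMeasures hν L.symm one_pos
  have hshift := h _ hνT (T x) (mem_support_map hT.aemeasurable hT.continuousAt hx)
  rw [map_rescale_map_sub] at hshift
  have hback := map_rescale_zero_mem_tangentMeasures hshift L hr
  rwa [map_rescale_map_rescale_zero, ContinuousLinearEquiv.symm_trans_self, one_mul] at hback

/-- The test vectors of the positive multiples of the blow-ups of `μ` at `a` with scale less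
than `δ`. -/
noncomputable def rescalingVectors (D : Set C_c(E, ℝ)) (L : E ≃L[ℝ] E) (μ : Measure E)
    (a : E) (δ : ℝ) : Set (D → ℝ) :=
  {v | ∃ c : ℝ≥0, 0 < c ∧ ∃ r : ℝ, 0 < r ∧ r < δ ∧
    testVector D (c • μ.map (rescale L a r)) = v}

variable [FiniteDimensional ℝ E]

theorem mem_tangentMeasures_iff {D : Set C_c(E, ℝ)} (hDc : D.Countable)
    (hD : IsConvergenceDetermining D) {L : E ≃L[ℝ] E} {μ : Measure E} [IsLocallyFiniteMeasure μ]
    {a : E} {ν : Measure E} :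
    ν ∈ tangentMeasures L μ a ↔ ν.Regular ∧ ν ≠ 0 ∧
      ∀ m : ℕ, testVector D ν ∈ closure (rescalingVectors D L μ a (1 / (m + 1))) := by
  have := hDc.to_subtype
  constructor
  · rintro ⟨hν, hν0, c, r, hc, hr, hr0, hlim⟩
    refine ⟨hν, hν0, fun m => mem_closure_of_tendsto (hlim.tendsto_testVector D) ?_⟩
    filter_upwards [hr0.eventually_lt_const (Nat.one_div_pos_of_nat (n := m))] with i hi
    exact ⟨c i, hc i, r i, hr i, hi, rfl⟩
  · rintro ⟨hν, hν0, hclosure⟩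
    obtain ⟨u, hu⟩ := (𝓝 (testVector D ν)).exists_antitone_basis
    have hnear (m : ℕ) : ∃ (c : ℝ≥0) (r : ℝ), 0 < c ∧ 0 < r ∧ r < 1 / ((m : ℝ) + 1) ∧
        testVector D (c • μ.map (rescale L a r)) ∈ u m := by
      obtain ⟨-, hv, c, hc, r, hr, hrm, rfl⟩ :=
        mem_closure_iff_nhds.1 (hclosure m) (u m) (hu.mem m)
      exact ⟨c, r, hc, hr, hrm, hv⟩
    choose c r hc hr hrm hv using hnear
    have (i : ℕ) : (μ.map (rescale L a (r i))).Regular := regular_map_rescale μ L a (hr i).ne'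
    exact ⟨hν, hν0, c, r, hc, hr, squeeze_zero (fun i => (hr i).le) (fun i => (hrm i).le)
      tendsto_one_div_add_atTop_nhds_zero_nat, hD (hu.tendsto hv)⟩

theorem mem_tangentMeasures_of_weakStarTendsto {L : E ≃L[ℝ] E} {μ : Measure E}
    [IsLocallyFiniteMeasure μ] {a : E} {σ : ℕ → Measure E} {τ : Measure E} [τ.Regular]
    (hσ : ∀ i, σ i ∈ tangentMeasures L μ a) (hτ : τ ≠ 0) (h : WeakStarTendsto σ τ) :
    τ ∈ tangentMeasures L μ a := by
  obtain ⟨D, hDc, hD⟩ := exists_countable_isConvergenceDetermining E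
  simp only [mem_tangentMeasures_iff hDc hD] at hσ ⊢
  exact ⟨inferInstance, hτ, fun m =>
    isClosed_closure.mem_of_tendsto (h.tendsto_testVector D) (.of_forall fun i => (hσ i).2.2 m)⟩

theorem tangentMeasures_subset_of_forall_map_rescale_mem {L : E ≃L[ℝ] E} {μ ν : Measure E}
    [IsLocallyFiniteMeasure μ] {a x : E}
    (h : ∀ r > 0, ν.map (rescale (.refl ℝ E) x r) ∈ tangentMeasures L μ a) :
    tangentMeasures (.refl ℝ E) ν x ⊆ tangentMeasures L μ a := by
  rintro τ ⟨_, hτ0, c, r, hc, hr, -, hlim⟩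
  exact mem_tangentMeasures_of_weakStarTendsto
    (fun i => smul_mem_tangentMeasures (h (r i) (hr i)) (hc i)) hτ0 hlim

theorem IsDensityPoint.eventually_exists_rescale_mem {μ ν : Measure E} [IsLocallyFiniteMeasure μ]
    [IsFiniteMeasureOnCompacts ν] {B : Set E} {a : E} (hB : IsDensityPoint μ B a) {c : ℕ → ℝ≥0}
    {r : ℕ → ℝ} (hr : ∀ i, 0 < r i) (hr0 : Tendsto r atTop (𝓝 0))
    (hlim : WeakStarTendsto (fun i => c i • μ.map (rescale (.refl ℝ E) a (r i))) ν) {x : E}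
    (hx : x ∈ ν.support) {U : Set E} (hU : U ∈ 𝓝 x) :
    ∀ᶠ i in atTop, ∃ b ∈ B, rescale (.refl ℝ E) a (r i) b ∈ U := by
  obtain ⟨ε, hε, hεU⟩ := Metric.mem_nhds_iff.1 hU
  set ρ := ε + dist x 0
  have hρ : 0 < ρ := by positivity
  have hsub : Metric.ball x ε ⊆ Metric.closedBall 0 ρ :=
    Metric.ball_subset_closedBall.trans (Metric.closedBall_subset_closedBall' le_rfl)
  have (i : ℕ) : (μ.map (rescale (.refl ℝ E) a (r i))).Regular :=
    regular_map_rescale μ _ a (hr i).ne'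
  obtain ⟨m, hm, hmU⟩ := hlim.exists_eventually_lt_measure hx Metric.isOpen_ball
    (Metric.mem_ball_self hε)
  obtain ⟨M, hM, hKM⟩ := hlim.exists_eventually_measure_le (isCompact_closedBall 0 ρ)
  have hmeas (i : ℕ) := (continuous_rescale (.refl ℝ E) a (r i)).measurable
  have happly (i : ℕ) {S : Set E} (hS : MeasurableSet S) :
      (c i • μ.map (rescale (.refl ℝ E) a (r i))) S =
        c i * μ (rescale (.refl ℝ E) a (r i) ⁻¹' S) := by
    rw [Measure.smul_apply, Measure.map_apply (hmeas i) hS, ENNReal.smul_def, smul_eq_mul]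
  simp only [happly _ Metric.isOpen_ball.measurableSet] at hmU
  simp only [happly _ Metric.isClosed_closedBall.measurableSet,
    rescale_refl_preimage_closedBall a (hr _)] at hKM
  have hscale : Tendsto (fun i => r i * ρ) atTop (𝓝[>] 0) := tendsto_nhdsWithin_iff.2
    ⟨by simpa only [zero_mul] using hr0.mul_const ρ, .of_forall fun i => mul_pos (hr i) hρ⟩
  have hmeet := eventually_nonempty_inter_of_tendsto_measure_div (hB.comp hscale)
    (fun i => hmeas i Metric.isOpen_ball.measurableSet)
    (fun i => rescale_refl_preimage_closedBall a (hr i) ρ ▸ Set.preimage_mono hsub)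
    (fun i => (isCompact_closedBall a (r i * ρ)).measure_ne_top) hm hM hmU hKM
  exact hmeet.mono fun i ⟨b, hbB, hb⟩ => ⟨b, hbB, hεU hb⟩

theorem not_isDensityPoint_of_mem_tangentMeasures {μ ν : Measure E} [IsLocallyFiniteMeasure μ]
    {a x : E} (hν : ν ∈ tangentMeasures (.refl ℝ E) μ a) (hx : x ∈ ν.support) {D : Set C_c(E, ℝ)}
    {V : Set (D → ℝ)} (hV : V ∈ 𝓝 (testVector D (ν.map (· - x)))) {δ : ℝ} (hδ : 0 < δ) :
    ¬ IsDensityPoint μ {b | Disjoint (rescalingVectors D (.refl ℝ E) μ b δ) V} a := by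
  intro hdens
  obtain ⟨_, -, c, r, hc, hr, hr0, hlim⟩ := hν
  have (i : ℕ) : (μ.map (rescale (.refl ℝ E) a (r i))).Regular :=
    regular_map_rescale μ _ a (hr i).ne'
  obtain ⟨P, hP, Q, hQ, hPQ⟩ :=
    eventually_prod_iff.1 ((hlim.tendsto_testVector_map_sub D x).eventually_mem hV)
  have hmeet := hdens.eventually_exists_rescale_mem hr hr0 hlim hx hQ
  obtain ⟨i, ⟨b, hb, hbQ⟩, hiP, hiδ⟩ :=
    (hmeet.and (hP.and (hr0.eventually_lt_const hδ))).exists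
  have hmem := hPQ hiP hbQ
  rw [Measure.map_smul, map_rescale_map_sub] at hmem
  exact Set.disjoint_left.1 hb ⟨c i, hc i, r i, hr i, hiδ, rfl⟩ hmem

theorem ae_map_sub_mem_tangentMeasures (μ : Measure E) [IsLocallyFiniteMeasure μ] :
    ∀ᵐ a ∂μ, ∀ ν ∈ tangentMeasures (.refl ℝ E) μ a, ∀ x ∈ ν.support,
      ν.map (· - x) ∈ tangentMeasures (.refl ℝ E) μ a := by
  obtain ⟨D, hDc, hD⟩ := exists_countable_isConvergenceDetermining E
  have := hDc.to_subtype
  let B (V : Set (D → ℝ)) (m : ℕ) : Set E :=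
    {b | Disjoint (rescalingVectors D (.refl ℝ E) μ b (1 / (m + 1))) V}
  have hdens : ∀ᵐ a ∂μ, ∀ V ∈ TopologicalSpace.countableBasis (D → ℝ), ∀ m : ℕ,
      a ∈ B V m → IsDensityPoint μ (B V m) a :=
    (ae_ball_iff (TopologicalSpace.countable_countableBasis _)).2 fun V _ => ae_all_iff.2 fun m =>
      ae_imp_of_ae_restrict (Besicovitch.ae_tendsto_measure_inter_div μ (B V m))
  filter_upwards [hdens] with a ha ν hν x hx
  have : ν.Regular := hν.1
  refine (mem_tangentMeasures_iff hDc hD).2 ⟨Measure.Regular.map (Homeomorph.subRight x),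
    (Measure.map_ne_zero_iff (continuous_sub_right x).aemeasurable).2 hν.2.1, fun m => ?_⟩
  by_contra hm
  obtain ⟨V, hVbasis, hxV, hV⟩ := (TopologicalSpace.isBasis_countableBasis _).mem_nhds_iff.1
    (isClosed_closure.isOpen_compl.mem_nhds hm)
  have haB : a ∈ B V m :=
    Set.disjoint_right.2 fun v hvV hv => hV hvV (subset_closure hv)
  exact not_isDensityPoint_of_mem_tangentMeasures hν hx
    ((TopologicalSpace.isOpen_of_mem_countableBasis hVbasis).mem_nhds hxV)
    Nat.one_div_pos_of_nat (ha V hVbasis m haB)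

theorem theoremt_general (μ : Measure E) [IsLocallyFiniteMeasure μ] :
    ∀ᵐ a ∂μ, ∀ L : E ≃L[ℝ] E, ∀ ν ∈ tangentMeasures L μ a,
      (∀ x ∈ ν.support, ∀ r : ℝ, 0 < r →
        ν.map (rescale (.refl ℝ E) x r) ∈ tangentMeasures L μ a) ∧
      (∀ x ∈ ν.support, tangentMeasures (.refl ℝ E) ν x ⊆ tangentMeasures L μ a) := by
  filter_upwards [ae_map_sub_mem_tangentMeasures μ] with a ha L ν hν
  have hrescale (x) (hx : x ∈ ν.support) (r : ℝ) (hr : 0 < r) :=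
    map_rescale_mem_tangentMeasures_of_map_sub_mem ha hν hx hr
  exact ⟨hrescale, fun x hx => tangentMeasures_subset_of_forall_map_rescale_mem (hrescale x hx)⟩

end Tangents

/-- The automorphism of Euclidean space given by an invertible matrix. -/
noncomputable def toEuclideanCLE {n : ℕ} (g : GL (Fin n) ℝ) :
    EuclideanSpace ℝ (Fin n) ≃L[ℝ] EuclideanSpace ℝ (Fin n) :=
  .ofUnit (Units.map (Matrix.toEuclideanCLM (𝕜 := ℝ) (n := Fin n)) g)

theorem theoremt {n : ℕ} (μ : Measure (EuclideanSpace ℝ (Fin n))) [μ.Regular]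
    (Λ : EuclideanSpace ℝ (Fin n) → GL (Fin n) ℝ) :
    ∀ᵐ a ∂μ, ∀ ν ∈ LambdaTan Λ μ a,
      (∀ x ∈ ν.support, ∀ r : ℝ, 0 < r → ν.map (transScale x r) ∈ LambdaTan Λ μ a) ∧
      (∀ x ∈ ν.support, Tan ν x ⊆ LambdaTan Λ μ a) := by
  filter_upwards [theoremt_general μ] with a ha
  exact ha (toEuclideanCLE (Λ a)⁻¹)
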